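/- Let $\xi_1,\xi_2,\dots$ be independent identically distributed random variables with values in $\{0,1,2,\dots\}$ and $\mathbf P(\xi_1=i)=p_i>0$ for all $i\ge 0$, $\sum_{i\ge0}p_i=1$. Put $$\bar\xi_n=\max_{1\le i\le n}\xi_i,\qquad R(n)=-\ln\Big(\sum_{i\ge n}p_i\Big)\ (n\ge0),\qquad r(n)=R(n)-R(n-1)\ (n\ge1),$$ $$a_n=\max\Big\{k\ge0:\ \sum_{i\ge k}p_i\ge\frac1n\Big\}\ (n\ge1).$$ Let $l\ge1$ be a fixed integer. Assume that $r$ is monotone (hence nondecreasing) on $\{1,2,\dots\}$, that $r(n)\to\infty$ and $r(n)/n\to0$ as $n\to\infty$, and that $$\sum_{k\ge1}\exp\big(-\exp((l-1)\,r(k))\big)=\infty .$$ Then $$\mathbf P\big(\bar\xi_n=a_n-l\ \text{ for infinitely many } n\big)=1 .$$ -/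

import Mathlib

open MeasureTheory ProbabilityTheory Filter Topology

namespace DiscreteMaxima

/-- The tail `P(ξ ≥ k) = ∑_{i ≥ k} p i` of the distribution `P(ξ = i) = p i`. -/
noncomputable def tail (p : ℕ → ℝ) (k : ℕ) : ℝ := ∑' i : ℕ, p (k + i)

/-- `R(n) = -ln P(ξ ≥ n)`. -/
noncomputable def R (p : ℕ → ℝ) (n : ℕ) : ℝ := -Real.log (tail p n)

/-- `r(n) = R(n) - R(n - 1)`, meant for `n ≥ 1` (the value at `n = 0` is `0`). -/
noncomputable def r (p : ℕ → ℝ) (n : ℕ) : ℝ := R p n - R p (n - 1)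

/-- `a_n = max {k ≥ 0 : P(ξ ≥ k) ≥ 1 / n}`, meant for `n ≥ 1`. For a probability distribution `p`
this set contains `0` and is bounded, so that the supremum in `ℕ` is its maximum. -/
noncomputable def a (p : ℕ → ℝ) (n : ℕ) : ℕ := sSup {k : ℕ | 1 / (n : ℝ) ≤ tail p k}

/-- The maximum of the first `n` terms `ξ 0, …, ξ (n - 1)` of a sequence of `ℕ`-valued
random variables, meant for `n ≥ 1`. -/
def maxFirst {Ω : Type*} (ξ : ℕ → Ω → ℕ) (n : ℕ) (ω : Ω) : ℕ :=
  (Finset.range n).sup fun i => ξ i ω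

end DiscreteMaxima

/-! Put `m = l - 1`, and let `level p k`, about `1 / P(ξ ≥ k)`, be the time when `a` reaches `k`.
Cut time at the levels of the multiples of `m + 1`. Let `B q` say that block `q` has maximum `(m +
1) * q`, and `D q` that nothing before the block exceeds this value. On `D q ∩ B q` the maximum at
the end of the block lags behind `a` by exactly `l`. The `B q` are independent, and by
`eventually_block_bound` their probabilities dominate a constant times `exp (-exp (m * r))` at the
next multiple of `m + 1`. By monotonicity of `r` they have infinite sum, so Borel–Cantelli gives
infinitely many `B q`. The `D q` are dependent, but their probabilities tend to 1 and each is
independent of the future, so the last-exit inequality `mul_measure_biUnion_le` gives infinitely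
many `D q ∩ B q`. -/

namespace DiscreteMaxima

/-! ### Borel–Cantelli with asymptotically certain past events. -/

section LastExit

variable {Ω : Type*} {mΩ : MeasurableSpace Ω} {μ : Measure Ω}
  {F G : ℕ → MeasurableSpace Ω} {B D : ℕ → Set Ω}

/-- Events, each measurable with respect to the past and to the future of consecutive independent
blocks, are independent. -/
theorem iIndepSet_of_blocks [IsProbabilityMeasure μ]
    (hG : ∀ q, G q ≤ mΩ) (hGanti : Antitone G)
    (hFG : ∀ q, Indep (F q) (G q) μ) (hBF : ∀ q, MeasurableSet[F (q + 1)] (B q))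
    (hBG : ∀ q, MeasurableSet[G q] (B q)) : iIndepSet B μ := by
  rw [iIndepSet_iff_meas_biInter fun q => hG q _ (hBG q)]
  intro s
  -- Inserting the least index leaves all the other events in its future `G (a + 1)`.
  induction s using Finset.induction_on_min with
  | empty => simp
  | insert a s has ih =>
    have ha : a ∉ s := fun h => lt_irrefl a (has a h)
    rw [Finset.set_biInter_insert, Finset.prod_insert ha, ← ih]
    refine (Indep_iff _ _ μ).1 (hFG (a + 1)) _ _ (hBF a) ?_
    exact Finset.measurableSet_biInter _ fun x hx => hGanti (has x hx) _ (hBG x)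

/-- The last-exit inequality: if the past events `D q` have probability at least `c`, then
the union of the events `D q ∩ B q` is at least `c` times as likely as that of the `B q`. -/
theorem mul_measure_biUnion_le {c : ENNReal} {n₀ : ℕ}
    (hF : ∀ q, F q ≤ mΩ) (hG : ∀ q, G q ≤ mΩ) (hGanti : Antitone G)
    (hFG : ∀ q, Indep (F q) (G q) μ) (hBG : ∀ q, MeasurableSet[G q] (B q))
    (hDF : ∀ q, MeasurableSet[F q] (D q)) (hc : ∀ q, n₀ ≤ q → c ≤ μ (D q)) (k : ℕ) :
    ∀ n, n₀ ≤ n → c * μ (⋃ i ∈ Finset.range k, B (n + i)) ≤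
      μ (⋃ i ∈ Finset.range k, D (n + i) ∩ B (n + i)) := by
  induction k with
  | zero => simp
  | succ k ih =>
    intro n hn
    have split : ∀ A : ℕ → Set Ω, (⋃ i ∈ Finset.range (k + 1), A (n + i)) =
        (⋃ i ∈ Finset.range k, A (n + 1 + i)) ∪ A n := by
      intro A
      ext ω
      simp only [Set.mem_iUnion, Finset.mem_range, Set.mem_union, exists_prop]
      constructor
      · rintro ⟨i, hi, h⟩
        rcases i with _ | i
        · exact Or.inr h
        · exact Or.inl ⟨i, by omega, by rwa [show n + 1 + i = n + (i + 1) by omega]⟩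
      · rintro (⟨i, hi, h⟩ | h)
        · exact ⟨i + 1, by omega, by rwa [show n + (i + 1) = n + 1 + i by omega]⟩
        · exact ⟨0, by omega, h⟩
    rw [split B, split fun q => D q ∩ B q]
    set U := ⋃ i ∈ Finset.range k, B (n + 1 + i) with hU
    set V := ⋃ i ∈ Finset.range k, D (n + 1 + i) ∩ B (n + 1 + i) with hV
    have hVU : V ⊆ U := Set.iUnion₂_mono fun i _ => Set.inter_subset_right
    have hUG : MeasurableSet[G n] U :=
      Finset.measurableSet_biUnion _ fun i _ => hGanti (by omega) _ (hBG _)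
    -- `B n \ U` says that `n` is the last index of the window at which `B` occurs; it depends on
    -- the future only, hence is independent of `D n`.
    have hBU : MeasurableSet[G n] (B n \ U) := (hBG n).diff hUG
    have hind : μ (D n ∩ (B n \ U)) = μ (D n) * μ (B n \ U) :=
      (Indep_iff _ _ μ).1 (hFG n) _ _ (hDF n) hBU
    calc c * μ (U ∪ B n) = c * μ U + c * μ (B n \ U) := by
          rw [← Set.union_sdiff_self, measure_union Set.disjoint_sdiff_right (hG n _ hBU), mul_add]
      _ ≤ μ V + μ (D n ∩ (B n \ U)) := by
          rw [hind]
          gcongr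
          · exact ih (n + 1) (by omega)
          · exact hc n hn
      _ = μ (V ∪ (D n ∩ (B n \ U))) := by
          rw [measure_union _ ((hF n _ (hDF n)).inter (hG n _ hBU))]
          exact Set.disjoint_left.2 fun ω h1 h2 => h2.2.2 (hVU h1)
      _ ≤ μ (V ∪ (D n ∩ B n)) := by
          gcongr
          exact Set.sdiff_subset

theorem ae_frequently_inter_of_blocks [IsProbabilityMeasure μ]
    (hF : ∀ q, F q ≤ mΩ) (hG : ∀ q, G q ≤ mΩ) (hGanti : Antitone G)
    (hFG : ∀ q, Indep (F q) (G q) μ) (hBF : ∀ q, MeasurableSet[F (q + 1)] (B q))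
    (hBG : ∀ q, MeasurableSet[G q] (B q)) (hDF : ∀ q, MeasurableSet[F q] (D q))
    (hB : ∑' q, μ (B q) = ⊤) (hD : Tendsto (fun q => μ (D q)) atTop (𝓝 1)) :
    ∀ᵐ ω ∂μ, ∃ᶠ q in atTop, ω ∈ D q ∩ B q := by
  have hBm : ∀ q, MeasurableSet (B q) := fun q => hG q _ (hBG q)
  have hlim : μ (limsup B atTop) = 1 :=
    measure_limsup_eq_one hBm (iIndepSet_of_blocks hG hGanti hFG hBF hBG) hB
  have hU : ∀ n, μ (⋃ i, B (n + i)) = 1 := by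
    intro n
    refine le_antisymm prob_le_one ?_
    rw [← hlim]
    refine measure_mono fun ω hω => ?_
    rw [mem_limsup_iff_frequently_mem, frequently_atTop] at hω
    obtain ⟨b, hb, h⟩ := hω n
    exact Set.mem_iUnion.2 ⟨b - n, by rwa [Nat.add_sub_cancel' hb]⟩
  have hV : ∀ n, μ (⋃ i, D (n + i) ∩ B (n + i)) = 1 := by
    intro n
    refine le_antisymm prob_le_one (le_of_forall_lt fun c hc => ?_)
    obtain ⟨c', hcc', hc'⟩ := exists_between hc
    refine hcc'.trans_le ?_
    obtain ⟨n₀, hn₀⟩ := eventually_atTop.1 (hD.eventually (lt_mem_nhds hc'))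
    set N := max n n₀
    have h1 : c' * μ (⋃ i, B (N + i)) ≤ μ (⋃ i, D (N + i) ∩ B (N + i)) := by
      have ht := tendsto_measure_iUnion_accumulate (μ := μ) (f := fun i => B (N + i))
      refine le_of_tendsto (ENNReal.Tendsto.const_mul ht (Or.inr (hc'.trans_le le_top).ne)) ?_
      filter_upwards with k
      have hk := mul_measure_biUnion_le hF hG hGanti hFG hBG hDF
        (fun q hq => (hn₀ q hq).le) (k + 1) N (le_max_right _ _)
      have e : Set.accumulate (fun i => B (N + i)) k = ⋃ i ∈ Finset.range (k + 1), B (N + i) := by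
        ext ω
        simp [Set.mem_accumulate]
      rw [e]
      refine hk.trans (measure_mono ?_)
      exact Set.iUnion₂_subset fun i _ => Set.subset_iUnion (fun i => D (N + i) ∩ B (N + i)) i
    rw [hU, mul_one] at h1
    refine h1.trans (measure_mono (Set.iUnion_subset fun i => ?_))
    have := Set.subset_iUnion (fun i => D (n + i) ∩ B (n + i)) (N - n + i)
    rwa [show n + (N - n + i) = N + i by omega] at this
  have hae : ∀ n, ∀ᵐ ω ∂μ, ω ∈ ⋃ i, D (n + i) ∩ B (n + i) := by
    intro n
    refine (mem_ae_iff_prob_eq_one ?_).2 (hV n)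
    exact MeasurableSet.iUnion fun i => (hF _ _ (hDF _)).inter (hBm _)
  filter_upwards [ae_all_iff.2 hae] with ω hω
  refine frequently_atTop.2 fun n => ?_
  obtain ⟨i, hi⟩ := Set.mem_iUnion.1 (hω n)
  exact ⟨n + i, by omega, hi⟩

end LastExit

/-! ### Tails, `R`, `r` and the value of `a`. -/

section Tail

variable {p : ℕ → ℝ}

theorem sum_range_add_tail (hp_sum : HasSum p 1) (k : ℕ) :
    ∑ i ∈ Finset.range k, p i + tail p k = 1 := by
  have h := hp_sum.summable.sum_add_tsum_nat_add k
  rw [hp_sum.tsum_eq] at h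
  simpa only [tail, add_comm k] using h

theorem tail_eq_add (hp_sum : HasSum p 1) (k : ℕ) : tail p k = p k + tail p (k + 1) := by
  have h0 := sum_range_add_tail hp_sum k
  have h1 := sum_range_add_tail hp_sum (k + 1)
  rw [Finset.sum_range_succ] at h1
  linarith

theorem tail_zero (hp_sum : HasSum p 1) : tail p 0 = 1 := by
  simpa using sum_range_add_tail hp_sum 0

theorem tail_pos (hp_pos : ∀ i, 0 < p i) (hp_sum : HasSum p 1) (k : ℕ) : 0 < tail p k := by
  rw [tail_eq_add hp_sum]
  have : 0 ≤ tail p (k + 1) := tsum_nonneg fun i => (hp_pos _).le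
  linarith [hp_pos k]

theorem tail_strictAnti (hp_pos : ∀ i, 0 < p i) (hp_sum : HasSum p 1) : StrictAnti (tail p) :=
  strictAnti_nat_of_succ_lt fun k => by linarith [hp_pos k, tail_eq_add hp_sum k]

theorem tail_le_one (hp_pos : ∀ i, 0 < p i) (hp_sum : HasSum p 1) (k : ℕ) : tail p k ≤ 1 :=
  tail_zero hp_sum ▸ (tail_strictAnti hp_pos hp_sum).antitone (Nat.zero_le k)

theorem exp_R (hp_pos : ∀ i, 0 < p i) (hp_sum : HasSum p 1) (k : ℕ) :
    Real.exp (R p k) = (tail p k)⁻¹ := by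
  rw [R, Real.exp_neg, Real.exp_log (tail_pos hp_pos hp_sum k)]

theorem tail_eq_exp (hp_pos : ∀ i, 0 < p i) (hp_sum : HasSum p 1) (k : ℕ) :
    tail p k = Real.exp (-R p k) := by
  rw [R, neg_neg, Real.exp_log (tail_pos hp_pos hp_sum k)]

theorem R_zero (hp_sum : HasSum p 1) : R p 0 = 0 := by simp [R, tail_zero hp_sum]

theorem R_strictMono (hp_pos : ∀ i, 0 < p i) (hp_sum : HasSum p 1) : StrictMono (R p) :=
  fun _ _ h => neg_lt_neg
    (Real.log_lt_log (tail_pos hp_pos hp_sum _) (tail_strictAnti hp_pos hp_sum h))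

theorem r_zero : r p 0 = 0 := by simp [r]

theorem R_succ (k : ℕ) : R p (k + 1) = R p k + r p (k + 1) := by simp [r]

theorem r_pos (hp_pos : ∀ i, 0 < p i) (hp_sum : HasSum p 1) (k : ℕ) : 0 < r p (k + 1) := by
  have := R_strictMono hp_pos hp_sum (Nat.lt_succ_self k)
  rw [Nat.succ_eq_add_one, R_succ] at this
  linarith

/-- The default value `r p 0 = 0` lies below `r p 1 > 0`. -/
theorem r_monotone (hp_pos : ∀ i, 0 < p i) (hp_sum : HasSum p 1)
    (hr_mono : MonotoneOn (r p) (Set.Ici 1)) : Monotone (r p) := by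
  refine monotone_nat_of_le_succ fun k => ?_
  rcases k with _ | k
  · rw [r_zero]
    exact (r_pos hp_pos hp_sum 0).le
  · exact hr_mono (Set.mem_Ici.2 (by omega)) (Set.mem_Ici.2 (by omega)) (by omega)

theorem R_add_le (hr : Monotone (r p)) (j m : ℕ) : R p (j + m) ≤ R p j + m * r p (j + m) := by
  induction m with
  | zero => simp
  | succ m ih =>
    have h1 : R p (j + (m + 1)) = R p (j + m) + r p (j + (m + 1)) := R_succ (j + m)
    have h2 : r p (j + m) ≤ r p (j + (m + 1)) := hr (by omega)
    have h3 : (m : ℝ) * r p (j + m) ≤ m * r p (j + (m + 1)) := by gcongr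
    push_cast
    linarith

theorem mul_r_one_le_R (hp_sum : HasSum p 1) (hr : Monotone (r p)) (k : ℕ) :
    k * r p 1 ≤ R p k := by
  induction k with
  | zero => simp [R_zero hp_sum]
  | succ k ih =>
    rw [R_succ]
    have : r p 1 ≤ r p (k + 1) := hr (by omega)
    push_cast
    linarith

theorem tendsto_R (hp_pos : ∀ i, 0 < p i) (hp_sum : HasSum p 1) (hr : Monotone (r p)) :
    Tendsto (R p) atTop atTop :=
  tendsto_atTop_mono (mul_r_one_le_R hp_sum hr)
    (tendsto_natCast_atTop_atTop.atTop_mul_const (r_pos hp_pos hp_sum 0))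

/-- If `1 / tail p k ≤ n < 1 / tail p (k + 1)`, then `a_n = k`. -/
theorem a_eq (hp_pos : ∀ i, 0 < p i) (hp_sum : HasSum p 1) {n k : ℕ}
    (h1 : Real.exp (R p k) ≤ n) (h2 : (n : ℝ) < Real.exp (R p (k + 1))) : a p n = k := by
  rw [exp_R hp_pos hp_sum] at h1 h2
  have hn : (0 : ℝ) < n := (inv_pos.2 (tail_pos hp_pos hp_sum k)).trans_le h1
  have : {j : ℕ | 1 / (n : ℝ) ≤ tail p j} = Set.Iic k := by
    ext j
    simp only [Set.mem_ofPred_eq, Set.mem_Iic, one_div]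
    constructor
    · intro h
      by_contra! hkj
      have h3 : tail p j ≤ tail p (k + 1) := (tail_strictAnti hp_pos hp_sum).antitone hkj
      have h4 := (lt_inv_comm₀ hn (tail_pos hp_pos hp_sum _)).1 h2
      linarith
    · intro h
      have h3 : tail p k ≤ tail p j := (tail_strictAnti hp_pos hp_sum).antitone h
      have h4 := (inv_le_comm₀ (tail_pos hp_pos hp_sum _) hn).1 h1
      linarith
  rw [a, this, csSup_Iic]

end Tail

/-! ### Bounds for powers of `1 - tail`. -/

section Estimates

variable {p : ℕ → ℝ}

theorem exp_neg_le_one_sub_pow {x : ℝ} (h1 : x ≤ 1 / 2) (n : ℕ) :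
    Real.exp (-(n * (x + 2 * x ^ 2))) ≤ (1 - x) ^ n := by
  rw [← mul_neg, Real.exp_nat_mul]
  refine pow_le_pow_left₀ (Real.exp_pos _).le ?_ n
  rw [Real.exp_neg, inv_le_comm₀ (Real.exp_pos _) (by linarith)]
  refine le_trans ?_ (Real.add_one_le_exp _)
  rw [inv_le_iff_one_le_mul₀ (by linarith)]
  nlinarith [mul_nonneg (sq_nonneg x) (by linarith : 0 ≤ 1 - 2 * x)]

theorem one_sub_pow_le {x y : ℝ} (hy : 0 ≤ y) (hyx : y ≤ x) (hx : x ≤ 1) (n : ℕ) :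
    (1 - x) ^ n ≤ Real.exp (-(n * (x - y))) * (1 - y) ^ n := by
  rw [← mul_neg, Real.exp_nat_mul, ← mul_pow]
  refine pow_le_pow_left₀ (by linarith) ?_ n
  have h := Real.add_one_le_exp (-(x - y))
  nlinarith [mul_le_mul_of_nonneg_right h (by linarith : 0 ≤ 1 - y), mul_nonneg hy (sub_nonneg.2 hyx)]

/-- The number of steps `⌈1 / P(ξ ≥ k)⌉` after which `a_n` reaches `k`. -/
noncomputable def level (p : ℕ → ℝ) (k : ℕ) : ℕ := ⌈Real.exp (R p k)⌉₊

theorem level_monotone (hp_pos : ∀ i, 0 < p i) (hp_sum : HasSum p 1) : Monotone (level p) :=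
  fun _ _ h => Nat.ceil_mono (Real.exp_le_exp.2 ((R_strictMono hp_pos hp_sum).monotone h))

theorem exp_R_le_level (k : ℕ) : Real.exp (R p k) ≤ level p k := Nat.le_ceil _

theorem level_lt (k : ℕ) : (level p k : ℝ) < Real.exp (R p k) + 1 :=
  Nat.ceil_lt_add_one (Real.exp_pos _).le

theorem one_le_exp_R (hp_pos : ∀ i, 0 < p i) (hp_sum : HasSum p 1) (k : ℕ) :
    1 ≤ Real.exp (R p k) := by
  rw [exp_R hp_pos hp_sum]
  exact (one_le_inv₀ (tail_pos hp_pos hp_sum k)).2 (tail_le_one hp_pos hp_sum k)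

theorem tendsto_level (hp_pos : ∀ i, 0 < p i) (hp_sum : HasSum p 1) (hr : Monotone (r p)) :
    Tendsto (level p) atTop atTop :=
  tendsto_nat_ceil_atTop.comp (Real.tendsto_exp_atTop.comp (tendsto_R hp_pos hp_sum hr))

theorem eventually_a_level (hp_pos : ∀ i, 0 < p i) (hp_sum : HasSum p 1)
    (hr_top : Tendsto (r p) atTop atTop) : ∀ᶠ k in atTop, a p (level p k) = k := by
  filter_upwards [(tendsto_add_atTop_iff_nat 1).2 hr_top |>.eventually_ge_atTop 1] with k hk
  refine a_eq hp_pos hp_sum (exp_R_le_level k) ((level_lt k).trans_le ?_)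
  rw [R_succ, Real.exp_add]
  nlinarith [one_le_exp_R hp_pos hp_sum k, Real.add_one_le_exp (r p (k + 1))]

/-- With probability tending to one, the first `level p j` variables do not exceed `j`. -/
theorem tendsto_one_sub_tail_pow_level (hp_pos : ∀ i, 0 < p i) (hp_sum : HasSum p 1)
    (hr_top : Tendsto (r p) atTop atTop) :
    Tendsto (fun j => (1 - tail p (j + 1)) ^ level p j) atTop (𝓝 1) := by
  -- Bernoulli's inequality, with `level p j ≤ 2 * exp (R p j)`.
  have hlow : Tendsto (fun j => 1 - 2 * Real.exp (-r p (j + 1))) atTop (𝓝 1) := by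
    have h := (Real.tendsto_exp_neg_atTop_nhds_zero.comp
      ((tendsto_add_atTop_iff_nat 1).2 hr_top)).const_mul 2 |>.const_sub 1
    simpa using h
  refine tendsto_of_tendsto_of_tendsto_of_le_of_le hlow tendsto_const_nhds (fun j => ?_)
    fun j => ?_
  · have ht := tail_pos hp_pos hp_sum (j + 1)
    have h1 := one_add_mul_le_pow (a := -tail p (j + 1))
      (by linarith [tail_le_one hp_pos hp_sum (j + 1)]) (level p j)
    have h2 : (level p j : ℝ) ≤ 2 * Real.exp (R p j) := by
      linarith [level_lt (p := p) j, one_le_exp_R hp_pos hp_sum j]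
    have h3 : Real.exp (R p j) * tail p (j + 1) = Real.exp (-r p (j + 1)) := by
      rw [tail_eq_exp hp_pos hp_sum, ← Real.exp_add, R_succ]
      ring_nf
    have h4 := mul_le_mul_of_nonneg_right h2 ht.le
    rw [mul_assoc, h3] at h4
    rw [← sub_eq_add_neg] at h1
    change 1 - 2 * Real.exp (-r p (j + 1)) ≤ _
    linarith
  · exact pow_le_one₀ (by linarith [tail_le_one hp_pos hp_sum (j + 1)])
      (by linarith [tail_pos hp_pos hp_sum (j + 1)])

/-- `R` grows at least linearly, while `r` is sublinear. This keeps the quadratic error in the next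
lemma bounded. -/
theorem eventually_mul_r_le_R (hp_pos : ∀ i, 0 < p i) (hp_sum : HasSum p 1)
    (hr : Monotone (r p)) (hr_small : Tendsto (fun n : ℕ => r p n / (n : ℝ)) atTop (𝓝 0))
    (m : ℕ) : ∀ᶠ j in atTop, m * r p (j + 1 + m) ≤ R p (j + 1) := by
  have hε : 0 < r p 1 / (2 * (m + 1)) := by
    have := r_pos hp_pos hp_sum 0
    positivity
  have h := (hr_small.comp (tendsto_add_atTop_nat (1 + m))).eventually (gt_mem_nhds hε)
  filter_upwards [h, eventually_ge_atTop m] with j hj hm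
  simp only [Function.comp, ← add_assoc] at hj
  have hR := mul_r_one_le_R hp_sum hr (j + 1)
  have hr1 : 0 < r p 1 := r_pos hp_pos hp_sum 0
  rw [div_lt_div_iff₀ (by positivity) (by positivity)] at hj
  have hm' : (m : ℝ) ≤ j := by exact_mod_cast hm
  have h0 : 0 ≤ r p (j + 1 + m) := by
    rw [← r_zero (p := p)]
    exact hr (Nat.zero_le _)
  push_cast at hj hR
  nlinarith [mul_le_mul_of_nonneg_right hm' hr1.le]

theorem exp_neg_exp_le_one_sub_tail_pow (hp_pos : ∀ i, 0 < p i) (hp_sum : HasSum p 1)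
    (hr : Monotone (r p)) {j m : ℕ} (hj : tail p (j + 1) ≤ 1 / 2)
    (hm : m * r p (j + 1 + m) ≤ R p (j + 1)) :
    Real.exp (-4) * Real.exp (-Real.exp (m * r p (j + 1 + m))) ≤
      (1 - tail p (j + 1)) ^ level p (j + 1 + m) := by
  have ht := tail_pos hp_pos hp_sum (j + 1)
  refine le_trans ?_ (exp_neg_le_one_sub_pow hj _)
  rw [← Real.exp_add, Real.exp_le_exp]
  set x := tail p (j + 1) with hx
  set e := Real.exp (m * r p (j + 1 + m)) with he
  have hCx : Real.exp (R p (j + 1 + m)) * x ≤ e := by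
    rw [hx, tail_eq_exp hp_pos hp_sum, ← Real.exp_add, he, Real.exp_le_exp]
    linarith [R_add_le hr (j + 1) m]
  have hex : e * x ≤ 1 := by
    rw [hx, tail_eq_exp hp_pos hp_sum, ← Real.exp_add, Real.exp_le_one_iff]
    linarith
  have h1 : (level p (j + 1 + m) : ℝ) * (x + 2 * x ^ 2) ≤
      (Real.exp (R p (j + 1 + m)) + 1) * (x + 2 * x ^ 2) := by
    have := (level_lt (p := p) (j + 1 + m)).le
    gcongr
  have h2 := mul_le_mul_of_nonneg_right hCx ht.le
  -- With `C = exp (R p (j + 1 + m))`: `C * x ≤ e`, `2 * C * x ^ 2 ≤ 2 * e * x ≤ 2` and `x + 2 * x ^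
  -- 2 ≤ 1`, so the exponent is at most `e + 3`.
  nlinarith

/-- A lower bound for the probability that the maximum of a block equals `j`. -/
theorem eventually_block_bound (hp_pos : ∀ i, 0 < p i) (hp_sum : HasSum p 1)
    (hr : Monotone (r p)) (hr_top : Tendsto (r p) atTop atTop)
    (hr_small : Tendsto (fun n : ℕ => r p n / (n : ℝ)) atTop (𝓝 0)) (m : ℕ) :
    ∀ᶠ j in atTop,
      Real.exp (-4) / 2 * Real.exp (-Real.exp (m * r p (j + 1 + m))) ≤
        (1 - tail p (j + 1)) ^ (level p (j + 1 + m) - level p j) -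
          (1 - tail p j) ^ (level p (j + 1 + m) - level p j) := by
  filter_upwards [eventually_mul_r_le_R hp_pos hp_sum hr hr_small m,
    (tendsto_add_atTop_iff_nat 1).2 hr_top |>.eventually_ge_atTop 3] with j hm hr3
  have ht := tail_pos hp_pos hp_sum (j + 1)
  have ht0 := tail_pos hp_pos hp_sum j
  have hle : tail p (j + 1) ≤ tail p j := (tail_strictAnti hp_pos hp_sum).antitone j.le_succ
  have hle1 := tail_le_one hp_pos hp_sum j
  have hA : Real.exp (R p j) * tail p j = 1 := by
    rw [exp_R hp_pos hp_sum, inv_mul_cancel₀ ht0.ne']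
  have hA1 := one_le_exp_R hp_pos hp_sum j
  have h4 : 4 * Real.exp (R p j) ≤ Real.exp (R p (j + 1)) := by
    rw [R_succ, Real.exp_add]
    nlinarith [Real.add_one_le_exp (r p (j + 1))]
  have hC : Real.exp (R p (j + 1)) ≤ Real.exp (R p (j + 1 + m)) :=
    Real.exp_le_exp.2 ((R_strictMono hp_pos hp_sum).monotone (by omega))
  have hA' : Real.exp (R p (j + 1)) * tail p (j + 1) = 1 := by
    rw [exp_R hp_pos hp_sum, inv_mul_cancel₀ ht.ne']
  have htt : 4 * tail p (j + 1) ≤ tail p j := by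
    have h5 := mul_le_mul_of_nonneg_right h4 ht.le
    have h6 := mul_le_mul_of_nonneg_right h5 ht0.le
    rw [hA', one_mul] at h6
    linear_combination h6 - 4 * tail p (j + 1) * hA
  set M := level p (j + 1 + m) - level p j with hM
  have hMcast : (M : ℝ) = level p (j + 1 + m) - level p j :=
    Nat.cast_sub (level_monotone hp_pos hp_sum (by omega))
  have hMlow : 2 * Real.exp (R p j) ≤ M := by
    linarith [exp_R_le_level (p := p) (j + 1 + m), level_lt (p := p) j]
  have hMp : 1 ≤ M * (tail p j - tail p (j + 1)) := by
    nlinarith [mul_le_mul_of_nonneg_right hMlow (sub_nonneg.2 hle)]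
  -- The block is long enough to contain the value `j`: the second power is at most half the first.
  have hhalf : Real.exp (-(M * (tail p j - tail p (j + 1)))) ≤ 1 / 2 := by
    rw [Real.exp_neg, one_div]
    exact inv_anti₀ two_pos (by linarith [Real.add_one_le_exp (M * (tail p j - tail p (j + 1)))])
  have hpow : 0 ≤ (1 - tail p (j + 1)) ^ M := pow_nonneg (by linarith) _
  have hB := one_sub_pow_le ht.le hle hle1 M
  have hB' := mul_le_mul_of_nonneg_right hhalf hpow
  have hE := exp_neg_exp_le_one_sub_tail_pow hp_pos hp_sum hr (by linarith) hm
  have hE' : (1 - tail p (j + 1)) ^ level p (j + 1 + m) ≤ (1 - tail p (j + 1)) ^ M :=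
    pow_le_pow_of_le_one (by linarith) (by linarith) (Nat.sub_le _ _)
  linarith

end Estimates

/-! ### Laws of block maxima. -/

section Probability

variable {Ω : Type*} {mΩ : MeasurableSpace Ω} {μ : Measure Ω} {p : ℕ → ℝ} {ξ : ℕ → Ω → ℕ}

theorem measure_lt (hp_pos : ∀ i, 0 < p i) (hp_sum : HasSum p 1)
    (hξ_meas : ∀ n, Measurable (ξ n))
    (hξ_law : ∀ n i, μ {ω | ξ n ω = i} = ENNReal.ofReal (p i)) (n v : ℕ) :
    μ {ω | ξ n ω < v} = ENNReal.ofReal (1 - tail p v) := by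
  have e : {ω | ξ n ω < v} = ⋃ i ∈ Finset.range v, {ω | ξ n ω = i} := by
    ext ω
    simp
  rw [e, measure_biUnion_finset]
  · simp_rw [hξ_law]
    rw [← ENNReal.ofReal_sum_of_nonneg fun i _ => (hp_pos i).le]
    congr 1
    linarith [sum_range_add_tail hp_sum v]
  · exact fun i _ j _ hij => Set.disjoint_left.2 fun ω h1 h2 => hij (h1.symm.trans h2)
  · exact fun i _ => hξ_meas n (measurableSet_singleton i)

theorem measure_forall_lt (hp_pos : ∀ i, 0 < p i) (hp_sum : HasSum p 1)
    (hξ_meas : ∀ n, Measurable (ξ n)) (hξ_indep : iIndepFun ξ μ)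
    (hξ_law : ∀ n i, μ {ω | ξ n ω = i} = ENNReal.ofReal (p i)) (s : Finset ℕ) (v : ℕ) :
    μ {ω | ∀ i ∈ s, ξ i ω < v} = ENNReal.ofReal ((1 - tail p v) ^ s.card) := by
  have e : {ω | ∀ i ∈ s, ξ i ω < v} = ⋂ i ∈ s, ξ i ⁻¹' Set.Iio v := by
    ext ω
    simp
  rw [e, hξ_indep.measure_inter_preimage_eq_mul s fun i _ => measurableSet_Iio]
  have h : ∀ i, μ (ξ i ⁻¹' Set.Iio v) = ENNReal.ofReal (1 - tail p v) :=
    fun i => measure_lt hp_pos hp_sum hξ_meas hξ_law i v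
  simp_rw [h]
  rw [Finset.prod_const, ENNReal.ofReal_pow (by linarith [tail_le_one hp_pos hp_sum v])]

theorem measurableSet_forall_lt {m : MeasurableSpace Ω} {s : Finset ℕ} (v : ℕ)
    (h : ∀ i ∈ s, Measurable[m] (ξ i)) : MeasurableSet[m] {ω | ∀ i ∈ s, ξ i ω < v} := by
  have e : {ω | ∀ i ∈ s, ξ i ω < v} = ⋂ i ∈ s, ξ i ⁻¹' Set.Iio v := by
    ext ω
    simp
  rw [e]
  exact Finset.measurableSet_biInter _ fun i hi => h i hi measurableSet_Iio

/-- The event that the maximum of `ξ i` over `i ∈ s` equals `v`. -/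
def blockMax (ξ : ℕ → Ω → ℕ) (s : Finset ℕ) (v : ℕ) : Set Ω :=
  {ω | ∀ i ∈ s, ξ i ω < v + 1} \ {ω | ∀ i ∈ s, ξ i ω < v}

theorem measure_blockMax [IsFiniteMeasure μ] (hp_pos : ∀ i, 0 < p i) (hp_sum : HasSum p 1)
    (hξ_meas : ∀ n, Measurable (ξ n)) (hξ_indep : iIndepFun ξ μ)
    (hξ_law : ∀ n i, μ {ω | ξ n ω = i} = ENNReal.ofReal (p i)) (s : Finset ℕ) (v : ℕ) :
    μ (blockMax ξ s v) =
      ENNReal.ofReal ((1 - tail p (v + 1)) ^ s.card - (1 - tail p v) ^ s.card) := by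
  have hsub : {ω | ∀ i ∈ s, ξ i ω < v} ⊆ {ω | ∀ i ∈ s, ξ i ω < v + 1} :=
    fun ω h i hi => (h i hi).trans v.lt_succ_self
  rw [blockMax, measure_sdiff hsub
    (measurableSet_forall_lt v fun i _ => hξ_meas i).nullMeasurableSet (measure_ne_top _ _),
    measure_forall_lt hp_pos hp_sum hξ_meas hξ_indep hξ_law,
    measure_forall_lt hp_pos hp_sum hξ_meas hξ_indep hξ_law, ENNReal.ofReal_sub]
  exact pow_nonneg (by linarith [tail_le_one hp_pos hp_sum v]) _

theorem maxFirst_eq_of_mem_blockMax {n n' v : ℕ} {ω : Ω}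
    (h : ω ∈ {ω | ∀ i ∈ Finset.range n, ξ i ω < v + 1} ∩ blockMax ξ (Finset.Ico n n') v) :
    maxFirst ξ n' ω = v := by
  obtain ⟨h1, h2, h3⟩ := h
  simp only [Set.mem_ofPred_eq, not_forall, not_lt, Finset.mem_range, Finset.mem_Ico] at h1 h2 h3
  obtain ⟨i, hi, hiv⟩ := h3
  refine le_antisymm (Finset.sup_le fun i hi => ?_) ?_
  · rcases lt_or_ge i n with h | h
    · exact Nat.lt_succ_iff.1 (h1 i h)
    · exact Nat.lt_succ_iff.1 (h2 i ⟨h, Finset.mem_range.1 hi⟩)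
  · exact hiv.trans (Finset.le_sup (f := fun i => ξ i ω) (Finset.mem_range.2 hi.2))

end Probability

/-! ### Application to the blocks. -/

/-- The events of the theorem along the subsequence `level p ((m + 1) * q)`. -/
theorem ae_frequently_blockMax {Ω : Type*} [MeasurableSpace Ω] {μ : Measure Ω}
    [IsProbabilityMeasure μ] {p : ℕ → ℝ} {ξ : ℕ → Ω → ℕ}
    (hp_pos : ∀ i, 0 < p i) (hp_sum : HasSum p 1)
    (hξ_meas : ∀ n, Measurable (ξ n)) (hξ_indep : iIndepFun ξ μ)
    (hξ_law : ∀ n i, μ {ω | ξ n ω = i} = ENNReal.ofReal (p i))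
    (hr : Monotone (r p)) (hr_top : Tendsto (r p) atTop atTop)
    (hr_small : Tendsto (fun n : ℕ => r p n / (n : ℝ)) atTop (𝓝 0)) (m : ℕ)
    (hdiv : ¬ Summable fun k : ℕ => Real.exp (-Real.exp (m * r p (k + 1)))) :
    ∀ᵐ ω ∂μ, ∃ᶠ q in atTop,
      ω ∈ {ω | ∀ i ∈ Finset.range (level p ((m + 1) * q)), ξ i ω < (m + 1) * q + 1} ∩
        blockMax ξ (Finset.Ico (level p ((m + 1) * q)) (level p ((m + 1) * (q + 1))))
          ((m + 1) * q) := by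
  have hmono : Monotone fun q => level p ((m + 1) * q) :=
    fun a b h => level_monotone hp_pos hp_sum (Nat.mul_le_mul_left _ h)
  have hsubseq : Tendsto (fun q => (m + 1) * q) atTop atTop :=
    tendsto_atTop_mono (fun q => Nat.le_mul_of_pos_left q m.succ_pos) tendsto_id
  set M : ℕ → MeasurableSpace Ω := fun i => MeasurableSpace.comap (ξ i) inferInstance with hM
  have hMle : ∀ i, M i ≤ ‹MeasurableSpace Ω› := fun i => (hξ_meas i).comap_le
  have hmeas : ∀ (S : Set ℕ) i, i ∈ S → Measurable[⨆ i ∈ S, M i] (ξ i) := fun S i hi =>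
    Measurable.mono (comap_measurable (ξ i)) (le_iSup₂_of_le i hi le_rfl) le_rfl
  refine ae_frequently_inter_of_blocks
    (F := fun q => ⨆ i ∈ Set.Iio (level p ((m + 1) * q)), M i)
    (G := fun q => ⨆ i ∈ Set.Ici (level p ((m + 1) * q)), M i)
    (D := fun q => {ω | ∀ i ∈ Finset.range (level p ((m + 1) * q)), ξ i ω < (m + 1) * q + 1})
    (B := fun q => blockMax ξ
      (Finset.Ico (level p ((m + 1) * q)) (level p ((m + 1) * (q + 1)))) ((m + 1) * q))
    (fun q => iSup₂_le fun i _ => hMle i) (fun q => iSup₂_le fun i _ => hMle i) ?_ ?_ ?_ ?_ ?_ ?_ ?_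
  · exact fun a b h => biSup_mono fun i hi => (hmono h).trans hi
  · exact fun q => indep_iSup_of_disjoint hMle hξ_indep
      (Set.disjoint_left.2 fun i h1 h2 => (Set.mem_Iio.1 h1).not_ge h2)
  · intro q
    have h : ∀ i ∈ Finset.Ico (level p ((m + 1) * q)) (level p ((m + 1) * (q + 1))),
        Measurable[⨆ i ∈ Set.Iio (level p ((m + 1) * (q + 1))), M i] (ξ i) :=
      fun i hi => hmeas _ i (Finset.mem_Ico.1 hi).2
    exact (measurableSet_forall_lt _ h).diff (measurableSet_forall_lt _ h)
  · intro q
    have h : ∀ i ∈ Finset.Ico (level p ((m + 1) * q)) (level p ((m + 1) * (q + 1))),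
        Measurable[⨆ i ∈ Set.Ici (level p ((m + 1) * q)), M i] (ξ i) :=
      fun i hi => hmeas _ i (Finset.mem_Ico.1 hi).1
    exact (measurableSet_forall_lt _ h).diff (measurableSet_forall_lt _ h)
  · exact fun q => measurableSet_forall_lt _ fun i hi => hmeas _ i (Finset.mem_range.1 hi)
  · by_contra hfin
    refine hdiv ?_
    simp_rw [measure_blockMax hp_pos hp_sum hξ_meas hξ_indep hξ_law, Nat.card_Ico] at hfin
    set f : ℕ → ℝ := fun k => Real.exp (-Real.exp (m * r p k)) with hf
    have hf_anti : Antitone f := fun a b h => by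
      have := hr h
      simp only [hf]
      gcongr
    -- For an antitone `f`, summability along one residue class mod `m + 1` is equivalent to full
    -- summability.
    rw [summable_nat_add_iff (f := f) 1,
      ← summable_indicator_mod_iff (m := m + 1) hf_anti ((0 : ℕ) : ZMod (m + 1)),
      summable_indicator_mod_iff_summable, ← summable_nat_add_iff 1]
    have hs := ENNReal.summable_toReal hfin
    have hc : (Real.exp (-4) / 2) ≠ 0 := by positivity
    rw [← summable_mul_left_iff hc]
    refine hs.of_norm_bounded_eventually_nat ?_
    filter_upwards [hsubseq.eventually
      (eventually_block_bound hp_pos hp_sum hr hr_top hr_small m)] with q hq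
    rw [show (m + 1) * q + 1 + m = (m + 1) * (q + 1) by ring] at hq
    have hpos : 0 ≤ Real.exp (-4) / 2 * f ((m + 1) * (q + 1) + 0) := by positivity
    rw [Real.norm_of_nonneg hpos, ENNReal.toReal_ofReal]
    · exact hq
    · exact hpos.trans hq
  · have h := ENNReal.tendsto_ofReal
      ((tendsto_one_sub_tail_pow_level hp_pos hp_sum hr_top).comp hsubseq)
    rw [ENNReal.ofReal_one] at h
    refine h.congr fun q => ?_
    rw [measure_forall_lt hp_pos hp_sum hξ_meas hξ_indep hξ_law, Finset.card_range]
    rfl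

end DiscreteMaxima

theorem theorem3 {Ω : Type*} [MeasurableSpace Ω] (μ : Measure Ω) [IsProbabilityMeasure μ]
    (p : ℕ → ℝ) (hp_pos : ∀ i, 0 < p i) (hp_sum : HasSum p 1)
    (ξ : ℕ → Ω → ℕ) (hξ_meas : ∀ n, Measurable (ξ n)) (hξ_indep : iIndepFun ξ μ)
    (hξ_law : ∀ n i, μ {ω | ξ n ω = i} = ENNReal.ofReal (p i))
    (l : ℤ) (hl : 1 ≤ l)
    (hr_mono : MonotoneOn (DiscreteMaxima.r p) (Set.Ici 1))
    (hr_top : Tendsto (DiscreteMaxima.r p) atTop atTop)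
    (hr_small : Tendsto (fun n : ℕ => DiscreteMaxima.r p n / (n : ℝ)) atTop (𝓝 0))
    (hdiv : ¬ Summable fun k : ℕ =>
      Real.exp (-Real.exp (((l : ℝ) - 1) * DiscreteMaxima.r p (k + 1)))) :
    μ {ω | ∃ᶠ n : ℕ in atTop,
      (DiscreteMaxima.maxFirst ξ n ω : ℤ) = (DiscreteMaxima.a p n : ℤ) - l} = 1 := by
  obtain ⟨m, rfl⟩ : ∃ m : ℕ, l = m + 1 := ⟨(l - 1).toNat, by omega⟩
  have hr := DiscreteMaxima.r_monotone hp_pos hp_sum hr_mono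
  have hdiv' : ¬ Summable fun k : ℕ =>
      Real.exp (-Real.exp (m * DiscreteMaxima.r p (k + 1))) := by simpa using hdiv
  have hae := DiscreteMaxima.ae_frequently_blockMax hp_pos hp_sum hξ_meas hξ_indep hξ_law hr
    hr_top hr_small m hdiv'
  have hsubseq : Tendsto (fun q => (m + 1) * (q + 1)) atTop atTop :=
    tendsto_atTop_mono (fun q => (Nat.le_succ q).trans (Nat.le_mul_of_pos_left _ m.succ_pos))
      tendsto_id
  rw [← measure_univ (μ := μ)]
  refine measure_congr (eventuallyEq_univ.2 ?_)
  filter_upwards [hae] with ω hω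
  -- The witness time is the end of block `q`, where `a` is `(m + 1) * (q + 1)` and the maximum is
  -- `(m + 1) * q`.
  refine ((DiscreteMaxima.tendsto_level hp_pos hp_sum hr).comp hsubseq).frequently
    ((hω.and_eventually (hsubseq.eventually
      (DiscreteMaxima.eventually_a_level hp_pos hp_sum hr_top))).mono ?_)
  rintro q ⟨hq, ha⟩
  simp only [Function.comp]
  rw [DiscreteMaxima.maxFirst_eq_of_mem_blockMax hq, ha]
  push_cast
  ring
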